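/- Let $\mathcal X$ be a token alphabet with end token $\mathrm{EOS}$, $P$ a target model decoded greedily (each next token is a fixed most likely token given the preceding ones), $\mathrm{pt}$ an initial prompt, and $S_1,\dots,S_K$ hyperparameter specifications (arms) for speculative decoding with maximum speculation length $L\ge 1$. In round $t=1,2,\dots$ an arm $I_t\in[K]$ is selected; arm $S_{I_t}$ drafts tokens (a chain or a tree) at the current prompt, the greedy verification by $P$ accepts at most $L$ of them, and these together with one bonus token of $P$ are appended to the prompt. Decoding stops after the first round whose tokens contain $\mathrm{EOS}$; the number of rounds is the stopping time $\mathrm{ST}$. Let $\mathrm{ST}(\mathtt{ALG}_i)$ be the stopping time when arm $i$ is used in all rounds, and let $\mathrm{len}(\mathrm{pt}_{\tau_{\mathrm c}})$ be the number of tokens generated by canonical token-by-token greedy decoding from $\mathrm{pt}$ up to and including the first $\mathrm{EOS}$. Assume: 1. (finite generation length) $\mathrm{len}(\mathrm{pt}_{\tau_{\mathrm c}})<\infty$; 2. (oblivious adversarial acceptance lengths) there are fixed numbers $y_{i,t}$ such that in every round $t$ before termination arm $i$ would produce exactly $y_{i,t}$ tokens (bonus token included), whatever arms were selected before; 3. the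 arms are selected by EXP3Spec: in each round $t$ before termination, given the past, $I_t=i$ with probability $$p_{t,i}=\frac{\exp\big(-\eta_t\sum_{s<t}\widehat Z_{i,s}\big)}{\sum_{j=1}^K\exp\big(-\eta_t\sum_{s<t}\widehat Z_{j,s}\big)},\qquad \eta_t=\sqrt{\frac{\log K}{tK}},\qquad \widehat Z_{i,s}=\mathbf 1\{I_s=i\}\,\frac{L+1-y_{i,s}}{L\,p_{s,i}};$$ 4. the stopping time $\mathrm{ST}(\mathtt{ALG})$ of this run satisfies $\mathrm{ST}(\mathtt{ALG})\ge\min_{i\in[K]}\mathrm{ST}(\mathtt{ALG}_i)$ almost surely. Then $\min_i\mathrm{ST}(\mathtt{ALG}_i)$ and $\mathbb E[\mathrm{ST}(\mathtt{ALG})]$ are finite, and $$\mathbb E[\mathrm{ST}(\mathtt{ALG})]-\min_{i\in[K]}\mathrm{ST}(\mathtt{ALG}_i)\le 2L\cdot\min\Big\{\sqrt{\mathrm{len}(\mathrm{pt}_{\tau_{\mathrm c}})\,K\log K},\ 2LK\log K+\sqrt{\min_{i\in[K]}\mathrm{ST}(\mathtt{ALG}_i)\,K\log K}\Big\}.$$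 -/

import Mathlib

open MeasureTheory
open scoped ENNReal

namespace BanditSpec

/-- A language model: the conditional law of the next token given a token sequence. -/
abbrev LLM (X : Type*) := List X → PMF X

/-- `g` is a greedy decoding rule for `P`: it always returns a most likely next token
(ties are broken in an arbitrary but fixed way). -/
def IsGreedy {X : Type*} (P : LLM X) (g : List X → X) : Prop :=
  ∀ (s : List X) (x : X), P s x ≤ P s (g s)

/-- The prompt after `t` steps of canonical (token by token) greedy decoding. -/
def canonicalPrompt {X : Type*} (g : List X → X) (pt : List X) : ℕ → List X
  | 0 => pt
  | t + 1 => canonicalPrompt g pt t ++ [g (canonicalPrompt g pt t)]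

/-- The number of tokens generated by canonical greedy decoding up to and including the first
`eos`; it is `⊤` if `eos` is never generated. -/
noncomputable def canonicalLength {X : Type*} (g : List X → X) (eos : X) (pt : List X) : ℕ∞ :=
  ⨅ (t : ℕ) (_ : g (canonicalPrompt g pt t) = eos), ((t + 1 : ℕ) : ℕ∞)

/-- A hyperparameter specification (arm): what it drafts in round `t = 1, 2, …` for a given
current prompt. A draft is a token tree, given by the set of its nodes, where a node is the token
sequence that leads to it from the root. A single drafted chain is the set of its prefixes. The
dependence on the round leaves room for an environment that changes over time. -/
abbrev Spec (X : Type*) := ℕ → List X → Set (List X)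

open Classical in
/-- Greedy verification of the draft tree `T` below the node `u`, with at most `n` further accepted
draft tokens: the target model's greedy token is always emitted, and verification goes on as long
as this token was drafted. The last emitted token is the bonus token. -/
noncomputable def verify {X : Type*} (g : List X → X) (T : Set (List X)) (pt : List X) :
    ℕ → List X → List X
  | 0, u => [g (pt ++ u)]
  | n + 1, u =>
      g (pt ++ u) ::
        (if u ++ [g (pt ++ u)] ∈ T then verify g T pt n (u ++ [g (pt ++ u)]) else [])

/-- A bandit configuration: target model, `K` hyperparameter specifications, and maximum
speculation length. -/
structure Config (X : Type*) (K : ℕ) where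
  P : LLM X
  S : Fin K → Spec X
  L : ℕ

/-- The accepted tokens (bonus token included) of the speculative decoding subroutine under greedy
decoding, with arm `i` in round `t` at the prompt `pt`. -/
noncomputable def specDecSub {X : Type*} {K : ℕ} (ν : Config X K) (g : List X → X)
    (i : Fin K) (t : ℕ) (pt : List X) : List X :=
  verify g (ν.S i t pt) pt ν.L []

/-- A history: the pairs (selected arm, accepted tokens), most recent round first. -/
abbrev History (X : Type*) (K : ℕ) := List (Fin K × List X)

/-- The current prompt: the initial prompt followed by all accepted tokens. -/
def currentPrompt {X : Type*} {K : ℕ} (pt : List X) : History X K → List X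
  | [] => pt
  | (_, x) :: h => currentPrompt pt h ++ x

/-- The history of the first `t` rounds when arm `a s` is selected in round `s + 1`. -/
noncomputable def history {X : Type*} {K : ℕ} (ν : Config X K) (g : List X → X) (pt : List X)
    (a : ℕ → Fin K) : ℕ → History X K
  | 0 => []
  | t + 1 =>
      (a t, specDecSub ν g (a t) (t + 1) (currentPrompt pt (history ν g pt a t))) ::
        history ν g pt a t

/-- The tokens accepted in the latest round contain `eos`. -/
def Stopped {X : Type*} {K : ℕ} (eos : X) : History X K → Prop
  | [] => False
  | (_, x) :: _ => eos ∈ x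

/-- The number of rounds until `eos` is generated, when arm `a s` is selected in round `s + 1`;
it is `⊤` if this never happens. -/
noncomputable def stoppingTime {X : Type*} {K : ℕ} (ν : Config X K) (g : List X → X) (eos : X)
    (pt : List X) (a : ℕ → Fin K) : ℕ∞ :=
  ⨅ (t : ℕ) (_ : Stopped eos (history ν g pt a t)), (t : ℕ∞)

/-- The smallest stopping time among the algorithms that use one fixed arm in all rounds. -/
noncomputable def bestFixedStoppingTime {X : Type*} {K : ℕ} (ν : Config X K) (g : List X → X)
    (eos : X) (pt : List X) : ℕ∞ :=
  ⨅ i : Fin K, stoppingTime ν g eos pt (fun _ => i)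

/-- Oblivious adversarial acceptance lengths: in every round `t + 1` that can be reached before
termination, each arm `i` would accept exactly `y i (t + 1)` tokens, whatever arms were selected
in the earlier rounds. -/
def ObliviousLengths {X : Type*} {K : ℕ} (ν : Config X K) (g : List X → X) (eos : X)
    (pt : List X) (y : Fin K → ℕ → ℕ) : Prop :=
  ∀ (a : ℕ → Fin K) (t : ℕ), (t : ℕ∞) < stoppingTime ν g eos pt a →
    ∀ i : Fin K,
      (specDecSub ν g i (t + 1) (currentPrompt pt (history ν g pt a t))).length = y i (t + 1)

/-- A randomized arm selection algorithm: the probability of each arm given the history. -/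
abbrev ArmAlg (X : Type*) (K : ℕ) := History X K → Fin K → ℝ

/-- The anytime learning rate `√(log K / (t K))`. -/
noncomputable def learningRate (K t : ℕ) : ℝ :=
  Real.sqrt (Real.log K / (t * K))

/-- Exponential weights with learning rate `η` and cumulative losses `Z`. -/
noncomputable def expWeights {K : ℕ} (η : ℝ) (Z : Fin K → ℝ) (i : Fin K) : ℝ :=
  Real.exp (-η * Z i) / ∑ j, Real.exp (-η * Z j)

/-- The cumulative importance-weighted loss estimates of EXP3Spec after the history `h`. -/
noncomputable def exp3Loss {X : Type*} {K : ℕ} (L : ℕ) : History X K → Fin K → ℝ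
  | [], _ => 0
  | (I, x) :: h, i =>
      exp3Loss L h i +
        if i = I then
          ((L : ℝ) + 1 - x.length) /
            (L * expWeights (learningRate K (h.length + 1)) (exp3Loss L h) i)
        else 0

/-- EXP3Spec: the probability of selecting arm `i` in round `t = h.length + 1`. -/
noncomputable def exp3Spec {X : Type*} {K : ℕ} (L : ℕ) : ArmAlg X K :=
  fun h i => expWeights (learningRate K (h.length + 1)) (exp3Loss L h) i

/-- On the probability space `(Ω, μ)`, the random arms `I 0, I 1, …` (`I t` is the arm of round
`t + 1`) are those of a run of BanditSpec with the arm selection algorithm `alg`: as long as the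
run has not terminated, the next arm has, given the past, the law prescribed by `alg`. The arms
after termination play no role and are unconstrained. -/
structure IsRun {X Ω : Type*} {K : ℕ} [MeasurableSpace Ω] (ν : Config X K) (g : List X → X)
    (eos : X) (pt : List X) (alg : ArmAlg X K) (μ : Measure Ω) (I : ℕ → Ω → Fin K) : Prop where
  measurable : ∀ t, Measurable (I t)
  law : ∀ (a : ℕ → Fin K) (t : ℕ), (t : ℕ∞) < stoppingTime ν g eos pt a →
    μ.real {ω | ∀ s ≤ t, I s ω = a s} =
      μ.real {ω | ∀ s < t, I s ω = a s} * alg (history ν g pt a t) (a t)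

/-- The expected stopping time of a run. -/
noncomputable def expectedStoppingTime {X Ω : Type*} {K : ℕ} [MeasurableSpace Ω]
    (ν : Config X K) (g : List X → X) (eos : X) (pt : List X) (μ : Measure Ω)
    (I : ℕ → Ω → Fin K) : ℝ≥0∞ :=
  ∫⁻ ω, (stoppingTime ν g eos pt (fun t => I t ω) : ℝ≥0∞) ∂μ

/-- The stopping time regret of a run: expected stopping time minus the smallest stopping time of
a fixed arm (meaningful when both are finite). -/
noncomputable def regret {X Ω : Type*} {K : ℕ} [MeasurableSpace Ω]
    (ν : Config X K) (g : List X → X) (eos : X) (pt : List X) (μ : Measure Ω)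
    (I : ℕ → Ω → Fin K) : ℝ :=
  (expectedStoppingTime ν g eos pt μ I).toReal - ((bestFixedStoppingTime ν g eos pt).toNat : ℝ)

end BanditSpec

/-! Under greedy verification every round emits the next block of the canonical output, of size
between `1` and `L + 1`, so a run stops exactly when its token count reaches the canonical length
`N`. Let a run need `T` rounds and the best fixed arm `i₀` need `S ≤ T`. The lengths of `i₀` sum to
at least `N` over `S` rounds and to at least `N + (T - S)` over `T` rounds, while the run overshoots
`N` by at most `L`. Hence `T - S` is at most the token regret over `T` rounds plus `L`
(`rounds_add_generated_le`).

Divided by `L`, token regret is bandit regret with losses in `[0, 1]`. The log-mean-exp analysis of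
EXP3 makes a compensated regret a supermartingale (`exp3Potential_step`), and optional stopping
applies because `T ≤ N` (`IsRun.integral_stopped_le`). The usual pathwise remainder `2 √(T K log K)`
must also absorb the overshoot, which is one unit after division by `L`; sharper constants provide
this when `T ≥ 4` (`exp3_bound_add_one_le`).

Concavity of the square root then gives `E[T] - S ≤ 2 L √(E[T] K log K)`; the case `S < 4` is
elementary. Bounding `E[T]` by `N` yields the first term of the minimum, solving the quadratic
inequality the second. -/

namespace BanditSpec

/-! ### Speculative decoding as a partition of the canonical output into blocks -/

section Decoding

variable {X : Type*} {K : ℕ}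

/-- The tokens emitted by greedy verification are a nonempty block of at most `n + 1` consecutive
tokens of the canonical decoding. -/
theorem exists_verify_eq (g : List X → X) (pt : List X) (T : Set (List X)) (p : List X) (n m : ℕ)
    (u : List X) (h : p ++ u = canonicalPrompt g pt m) :
    ∃ k, 1 ≤ k ∧ k ≤ n + 1 ∧
      verify g T p n u = (List.range' m k).map (fun j => g (canonicalPrompt g pt j)) ∧
      p ++ u ++ verify g T p n u = canonicalPrompt g pt (m + k) := by
  induction n generalizing m u with
  | zero =>
    refine ⟨1, le_rfl, le_rfl, ?_, ?_⟩
    · simp [verify, h]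
    · simp only [verify, canonicalPrompt, h]
  | succ n ih =>
    by_cases hT : u ++ [g (p ++ u)] ∈ T
    · obtain ⟨k, h1, h2, h3, h4⟩ := ih (m + 1) (u ++ [g (p ++ u)]) (by
        rw [← List.append_assoc, h]; rfl)
      refine ⟨k + 1, by omega, by omega, ?_, ?_⟩
      · rw [verify, if_pos hT, h3, h, List.range'_succ]; rfl
      · rw [verify, if_pos hT]
        rw [show m + (k + 1) = m + 1 + k by omega, ← h4]
        simp
    · refine ⟨1, le_rfl, by omega, ?_, ?_⟩
      · rw [verify, if_neg hT, h]; rfl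
      · simp only [verify, if_neg hT, canonicalPrompt, h]

/-- The number of tokens generated in a history. -/
def generated : History X K → ℕ
  | [] => 0
  | (_, x) :: h => generated h + x.length

theorem length_history (ν : Config X K) (g : List X → X) (pt : List X) (a : ℕ → Fin K) (t : ℕ) :
    (history ν g pt a t).length = t := by
  induction t with
  | zero => rfl
  | succ t ih => simp [history, ih]

theorem history_congr (ν : Config X K) (g : List X → X) (pt : List X) {a b : ℕ → Fin K} {t : ℕ}
    (h : ∀ s < t, a s = b s) : history ν g pt a t = history ν g pt b t := by
  induction t with
  | zero => rfl
  | succ t ih =>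
    have := ih fun s hs => h s (by omega)
    simp only [history, this, h t (by omega)]

theorem currentPrompt_history (ν : Config X K) (g : List X → X) (pt : List X) (a : ℕ → Fin K)
    (t : ℕ) : currentPrompt pt (history ν g pt a t) =
      canonicalPrompt g pt (generated (history ν g pt a t)) := by
  induction t with
  | zero => rfl
  | succ t ih =>
    obtain ⟨k, -, -, h3, h4⟩ := exists_verify_eq g pt
      (ν.S (a t) (t + 1) (currentPrompt pt (history ν g pt a t)))
      (currentPrompt pt (history ν g pt a t)) ν.L _ [] (by rw [List.append_nil, ih])
    simp only [history, currentPrompt, generated, specDecSub]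
    rw [List.append_nil] at h4
    rw [h4, h3]
    simp

theorem exists_specDecSub_eq (ν : Config X K) (g : List X → X) (pt : List X) (a : ℕ → Fin K)
    (t : ℕ) (i : Fin K) :
    ∃ k, 1 ≤ k ∧ k ≤ ν.L + 1 ∧
      specDecSub ν g i (t + 1) (currentPrompt pt (history ν g pt a t)) =
        (List.range' (generated (history ν g pt a t)) k).map
          (fun j => g (canonicalPrompt g pt j)) := by
  obtain ⟨k, h1, h2, h3, -⟩ := exists_verify_eq g pt
      (ν.S i (t + 1) (currentPrompt pt (history ν g pt a t)))
      (currentPrompt pt (history ν g pt a t)) ν.L _ []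
      (by rw [List.append_nil, currentPrompt_history])
  exact ⟨k, h1, h2, h3⟩

theorem length_specDecSub (ν : Config X K) (g : List X → X) (pt : List X) (a : ℕ → Fin K)
    (t : ℕ) (i : Fin K) :
    1 ≤ (specDecSub ν g i (t + 1) (currentPrompt pt (history ν g pt a t))).length ∧
      (specDecSub ν g i (t + 1) (currentPrompt pt (history ν g pt a t))).length ≤ ν.L + 1 := by
  obtain ⟨k, h1, h2, h3⟩ := exists_specDecSub_eq ν g pt a t i
  rw [h3]; simpa using ⟨h1, h2⟩

theorem generated_history_succ (ν : Config X K) (g : List X → X) (pt : List X) (a : ℕ → Fin K)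
    (t : ℕ) : generated (history ν g pt a (t + 1)) = generated (history ν g pt a t) +
      (specDecSub ν g (a t) (t + 1) (currentPrompt pt (history ν g pt a t))).length := rfl

theorem le_generated_history (ν : Config X K) (g : List X → X) (pt : List X) (a : ℕ → Fin K)
    (t : ℕ) : t ≤ generated (history ν g pt a t) := by
  induction t with
  | zero => simp
  | succ t ih =>
    have := (length_specDecSub ν g pt a t (a t)).1
    rw [generated_history_succ]; omega

theorem generated_history_mono (ν : Config X K) (g : List X → X) (pt : List X) (a : ℕ → Fin K) :
    Monotone fun t => generated (history ν g pt a t) :=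
  monotone_nat_of_le_succ fun t => by rw [generated_history_succ]; omega

/-- The canonical length `n` is characterized by the first position of `eos`. -/
theorem canonicalLength_spec {g : List X → X} {eos : X} {pt : List X}
    (hfin : canonicalLength g eos pt ≠ ⊤) :
    1 ≤ (canonicalLength g eos pt).toNat ∧
    g (canonicalPrompt g pt ((canonicalLength g eos pt).toNat - 1)) = eos ∧
      ∀ t, g (canonicalPrompt g pt t) = eos → (canonicalLength g eos pt).toNat ≤ t + 1 := by
  classical
  have hex : ∃ t, g (canonicalPrompt g pt t) = eos := by
    by_contra! h
    exact hfin (by simp [canonicalLength, h])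
  have hN : canonicalLength g eos pt = ((Nat.find hex + 1 : ℕ) : ℕ∞) := by
    apply le_antisymm
    · unfold canonicalLength
      exact iInf₂_le (Nat.find hex) (Nat.find_spec hex)
    · exact le_iInf₂ fun t ht => by
        have := Nat.find_min' hex ht
        exact_mod_cast Nat.add_le_add_right this 1
  rw [hN, ENat.toNat_natCast]
  refine ⟨by omega, by simpa using Nat.find_spec hex, fun t ht => ?_⟩
  have := Nat.find_min' hex ht
  omega

theorem stopped_history_succ_iff (ν : Config X K) {g : List X → X} {eos : X} {pt : List X}
    (a : ℕ → Fin K) (t : ℕ) :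
    Stopped eos (history ν g pt a (t + 1)) ↔
      ∃ m, generated (history ν g pt a t) ≤ m ∧ m < generated (history ν g pt a (t + 1)) ∧
        g (canonicalPrompt g pt m) = eos := by
  obtain ⟨k, h1, h2, h3⟩ := exists_specDecSub_eq ν g pt a t (a t)
  rw [generated_history_succ, h3]
  simp only [history, Stopped, h3, List.mem_map, List.mem_range'_1, List.length_map,
    List.length_range', and_assoc]

/-- A run stops as soon as the number of generated tokens reaches the canonical length. -/
theorem lt_stoppingTime_iff (ν : Config X K) {g : List X → X} {eos : X} {pt : List X}
    (hfin : canonicalLength g eos pt ≠ ⊤) (a : ℕ → Fin K) (t : ℕ) :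
    (t : ℕ∞) < stoppingTime ν g eos pt a ↔
      generated (history ν g pt a t) < (canonicalLength g eos pt).toNat := by
  obtain ⟨hN1, hN, hmin⟩ := canonicalLength_spec hfin
  set N := (canonicalLength g eos pt).toNat
  constructor
  · intro h
    by_contra! hle
    have : ∃ s ≤ t, Stopped eos (history ν g pt a s) := by
      clear h
      induction t with
      | zero => simp [history, generated] at hle; omega
      | succ t ih =>
        by_cases h' : N ≤ generated (history ν g pt a t)
        · obtain ⟨s, hs, h⟩ := ih h'
          exact ⟨s, by omega, h⟩
        · exact ⟨t + 1, le_rfl, (stopped_history_succ_iff ν a t).2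
            ⟨N - 1, by omega, by omega, hN⟩⟩
    obtain ⟨s, hs, hst⟩ := this
    have h1 : stoppingTime ν g eos pt a ≤ (s : ℕ∞) := iInf₂_le s hst
    have h2 : (s : ℕ∞) ≤ t := by exact_mod_cast hs
    exact absurd h (not_lt.2 (h1.trans h2))
  · intro h
    have : ((t + 1 : ℕ) : ℕ∞) ≤ stoppingTime ν g eos pt a := by
      refine le_iInf₂ fun s hs => ?_
      by_contra! hlt
      have hlt : s ≤ t := by
        have : s < t + 1 := by exact_mod_cast hlt
        omega
      cases s with
      | zero => exact hs
      | succ s =>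
        obtain ⟨m, -, hm, he⟩ := (stopped_history_succ_iff ν a s).1 hs
        have := generated_history_mono ν g pt a hlt
        have := hmin m he
        simp only at *
        omega
    exact lt_of_lt_of_le (by exact_mod_cast Nat.lt_succ_self t) this

theorem stoppingTime_le (ν : Config X K) {g : List X → X} {eos : X} {pt : List X}
    (hfin : canonicalLength g eos pt ≠ ⊤) (a : ℕ → Fin K) :
    stoppingTime ν g eos pt a ≤ ((canonicalLength g eos pt).toNat : ℕ∞) := by
  by_contra! h
  have := (lt_stoppingTime_iff ν hfin a _).1 h
  have := le_generated_history ν g pt a (canonicalLength g eos pt).toNat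
  omega

/-- The stopping time of a terminating run as a natural number. -/
noncomputable def rounds (ν : Config X K) (g : List X → X) (eos : X) (pt : List X)
    (a : ℕ → Fin K) : ℕ := (stoppingTime ν g eos pt a).toNat

theorem coe_rounds (ν : Config X K) {g : List X → X} {eos : X} {pt : List X}
    (hfin : canonicalLength g eos pt ≠ ⊤) (a : ℕ → Fin K) :
    (rounds ν g eos pt a : ℕ∞) = stoppingTime ν g eos pt a :=
  ENat.natCast_toNat (ne_top_of_le_ne_top (ENat.natCast_ne_top _) (stoppingTime_le ν hfin a))

theorem lt_rounds_iff (ν : Config X K) {g : List X → X} {eos : X} {pt : List X}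
    (hfin : canonicalLength g eos pt ≠ ⊤) (a : ℕ → Fin K) (t : ℕ) :
    t < rounds ν g eos pt a ↔
      generated (history ν g pt a t) < (canonicalLength g eos pt).toNat := by
  rw [← lt_stoppingTime_iff ν hfin, ← coe_rounds ν hfin]; norm_cast

theorem rounds_le (ν : Config X K) {g : List X → X} {eos : X} {pt : List X}
    (hfin : canonicalLength g eos pt ≠ ⊤) (a : ℕ → Fin K) :
    rounds ν g eos pt a ≤ (canonicalLength g eos pt).toNat := by
  have := stoppingTime_le ν hfin a
  rw [← coe_rounds ν hfin] at this
  exact_mod_cast this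

/-- No round emits more than `L + 1` tokens. This crude bound settles the case in which the best arm
stops in fewer than four rounds. -/
theorem canonicalLength_le_mul_rounds (ν : Config X K) {g : List X → X} {eos : X} {pt : List X}
    (hfin : canonicalLength g eos pt ≠ ⊤) (a : ℕ → Fin K) :
    (canonicalLength g eos pt).toNat ≤ (ν.L + 1) * rounds ν g eos pt a := by
  have h1 := (lt_rounds_iff ν hfin a (rounds ν g eos pt a)).not.1 (lt_irrefl _)
  have h2 : ∀ t, generated (history ν g pt a t) ≤ (ν.L + 1) * t := by
    intro t
    induction t with
    | zero => simp [history, generated]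
    | succ t ih =>
      have := (length_specDecSub ν g pt a t (a t)).2
      rw [generated_history_succ]; nlinarith
  exact (not_lt.1 h1).trans (h2 _)

theorem generated_history_eq_sum (ν : Config X K) {g : List X → X} {eos : X} {pt : List X}
    (hfin : canonicalLength g eos pt ≠ ⊤) {y : Fin K → ℕ → ℕ}
    (hy : ObliviousLengths ν g eos pt y) (a : ℕ → Fin K) {t : ℕ}
    (ht : t ≤ rounds ν g eos pt a) :
    generated (history ν g pt a t) = ∑ s ∈ Finset.range t, y (a s) (s + 1) := by
  induction t with
  | zero => rfl
  | succ t ih =>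
    rw [generated_history_succ, ih (by omega), Finset.sum_range_succ,
      hy a t (by rw [← coe_rounds ν hfin]; exact_mod_cast ht)]

theorem one_le_length (ν : Config X K) {g : List X → X} {eos : X} {pt : List X}
    (hfin : canonicalLength g eos pt ≠ ⊤) {y : Fin K → ℕ → ℕ}
    (hy : ObliviousLengths ν g eos pt y) (a : ℕ → Fin K) {t : ℕ}
    (ht : t < rounds ν g eos pt a) (i : Fin K) : 1 ≤ y i (t + 1) ∧ y i (t + 1) ≤ ν.L + 1 := by
  rw [← hy a t (by rw [← coe_rounds ν hfin]; exact_mod_cast ht)]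
  exact length_specDecSub ν g pt a t i

/-- A run that is slower than the fixed arm `i` has generated fewer tokens, up to the
overshoot in its last round. -/
theorem rounds_add_generated_le (ν : Config X K) {g : List X → X} {eos : X} {pt : List X}
    (hfin : canonicalLength g eos pt ≠ ⊤) {y : Fin K → ℕ → ℕ}
    (hy : ObliviousLengths ν g eos pt y) (a : ℕ → Fin K) (i : Fin K)
    (hle : rounds ν g eos pt (fun _ => i) ≤ rounds ν g eos pt a) :
    rounds ν g eos pt a + generated (history ν g pt a (rounds ν g eos pt a)) ≤
      rounds ν g eos pt (fun _ => i) +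
        ∑ s ∈ Finset.range (rounds ν g eos pt a), y i (s + 1) + ν.L := by
  obtain ⟨hN1, -, -⟩ := canonicalLength_spec hfin
  have h1 := (lt_rounds_iff ν hfin (fun _ => i) (rounds ν g eos pt (fun _ => i))).not.1
    (lt_irrefl _)
  rw [generated_history_eq_sum ν hfin hy (fun _ => i) le_rfl] at h1
  have hone := fun t ht => one_le_length ν hfin hy a (t := t) ht i
  have hg : generated (history ν g pt a (rounds ν g eos pt a)) ≤
      (canonicalLength g eos pt).toNat + ν.L := by
    rcases Nat.eq_zero_or_pos (rounds ν g eos pt a) with h0 | h0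
    · rw [h0]; simp [history, generated]
    · obtain ⟨t, ht⟩ := Nat.exists_eq_add_of_lt h0
      rw [zero_add] at ht
      have h2 := (lt_rounds_iff ν hfin a t).1 (by omega)
      have h3 := (length_specDecSub ν g pt a t (a t)).2
      rw [ht, generated_history_succ]; omega
  generalize rounds ν g eos pt (fun _ => i) = S at *
  generalize rounds ν g eos pt a = T at *
  obtain ⟨d, rfl⟩ := Nat.exists_eq_add_of_le hle
  -- The run of arm `i` has ended by these rounds, but the run `a` has not, and this is what forces
  -- the lengths to be at least one.
  have h4 : d ≤ ∑ s ∈ Finset.range d, y i (S + s + 1) := by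
    calc d = ∑ s ∈ Finset.range d, 1 := by simp
      _ ≤ _ := Finset.sum_le_sum fun s hs => (hone (S + s) (by
        have := Finset.mem_range.1 hs; omega)).1
  rw [Finset.sum_range_add]
  omega

/-- Stopping after `t` rounds is decided by the first `t` arms alone: the stopping time property,
stated on paths. -/
theorem rounds_congr_of_le (ν : Config X K) {g : List X → X} {eos : X} {pt : List X}
    (hfin : canonicalLength g eos pt ≠ ⊤) {a b : ℕ → Fin K} {t : ℕ}
    (h : ∀ s < t, a s = b s) (ha : rounds ν g eos pt a = t) : rounds ν g eos pt b = t := by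
  apply le_antisymm
  · by_contra! hlt
    rw [lt_rounds_iff ν hfin, ← history_congr ν g pt h, ← lt_rounds_iff ν hfin] at hlt
    omega
  · rcases t with _ | t
    · omega
    · have : t < rounds ν g eos pt a := by omega
      rw [lt_rounds_iff ν hfin, history_congr ν g pt fun s hs => h s (by omega),
        ← lt_rounds_iff ν hfin] at this
      omega

theorem rounds_pos (ν : Config X K) {g : List X → X} {eos : X} {pt : List X}
    (hfin : canonicalLength g eos pt ≠ ⊤) (a : ℕ → Fin K) : 0 < rounds ν g eos pt a := by
  rw [lt_rounds_iff ν hfin]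
  exact (canonicalLength_spec hfin).1

end Decoding

/-! ### Exponential weights: one-step potential estimates -/

section ExpWeights

open Real

/-- Follows from `exp x ≥ 1 + x + x²/2` and `(1 + x + x²/2) (1 - x + x²/2) = 1 + x⁴/4 ≥ 1`. -/
theorem exp_neg_le_quadratic {x : ℝ} (hx : 0 ≤ x) : exp (-x) ≤ 1 - x + x ^ 2 / 2 := by
  have h1 := Real.quadratic_le_exp_of_nonneg hx
  have h2 : 0 < 1 - x + x ^ 2 / 2 := by nlinarith [sq_nonneg (x - 1)]
  rw [Real.exp_neg, inv_le_comm₀ (exp_pos _) h2]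
  refine le_trans ?_ h1
  rw [inv_le_iff_one_le_mul₀ h2]
  nlinarith [sq_nonneg (x ^ 2)]

theorem mix_exp_neg_le {p x : ℝ} (hp : 0 ≤ p) (hx : 0 ≤ x) :
    1 - p + p * exp (-x) ≤ exp (-(p * x) + p * x ^ 2 / 2) := by
  have h1 := mul_le_mul_of_nonneg_left (exp_neg_le_quadratic hx) hp
  have h2 := Real.add_one_le_exp (-(p * x) + p * x ^ 2 / 2)
  linarith

/-- Hoeffding's lemma for a Bernoulli variable. -/
theorem mix_exp_neg_le_hoeffding {p : ℝ} (hp : 0 ≤ p) (hp1 : p ≤ 1) (x : ℝ) :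
    1 - p + p * exp (-x) ≤ exp (-(p * x) + x ^ 2 / 8) := by
  let μ : Measure ℝ := ENNReal.ofReal (1 - p) • Measure.dirac 0 + ENNReal.ofReal p • Measure.dirac 1
  have hμ : IsProbabilityMeasure μ := ⟨by
    simp [μ, ← ENNReal.ofReal_add (sub_nonneg.2 hp1) hp]⟩
  have hint : ∀ f : ℝ → ℝ, ∫ z, f z ∂μ = (1 - p) * f 0 + p * f 1 := by
    intro f
    rw [integral_add_measure, integral_smul_measure, integral_smul_measure, integral_dirac,
      integral_dirac, ENNReal.toReal_ofReal hp, ENNReal.toReal_ofReal (sub_nonneg.2 hp1)]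
    · rfl
    · exact (integrable_dirac (by simp)).smul_measure (by simp)
    · exact (integrable_dirac (by simp)).smul_measure (by simp)
  have hb : ∀ᵐ z ∂μ, id z ∈ Set.Icc (0 : ℝ) 1 := by
    rw [ae_add_measure_iff]
    exact ⟨Measure.ae_smul_measure (by simp [ae_dirac_eq]) _, Measure.ae_smul_measure (by simp [ae_dirac_eq]) _⟩
  -- A variable in `[0, 1]` has variance proxy `1/4`, whence `x²/8`; the mean under `μ` is `p`.
  have h := (ProbabilityTheory.hasSubgaussianMGF_of_mem_Icc aemeasurable_id hb).mgf_le (-x)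
  rw [ProbabilityTheory.mgf, hint, hint] at h
  simp only [id, mul_zero, mul_one, zero_add, zero_sub, sub_zero] at h
  have e1 : exp (-x * -p) = exp (p * x) := by congr 1; ring
  have e2 : exp (-x * (1 - p)) = exp (p * x) * exp (-x) := by rw [← exp_add]; congr 1; ring
  rw [e1, e2] at h
  have e3 : exp (-(p * x) + x ^ 2 / 8) = exp (-(p * x)) * exp (x ^ 2 / 8) := exp_add _ _
  have e4 : exp (-(p * x)) * exp (p * x) = 1 := by rw [← exp_add]; simp
  rw [e3]
  calc 1 - p + p * exp (-x)
      = exp (-(p * x)) * ((1 - p) * exp (p * x) + p * (exp (p * x) * exp (-x))) := by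
        linear_combination (-(1 - p) - p * exp (-x)) * e4
    _ ≤ _ := by
        gcongr
        refine h.trans_eq ?_
        congr 1
        simp
        ring

/-- The second moment bound `p/2` is the better one for small `p`, Hoeffding's `1/8` for `p > 1/4`.
-/
theorem log_mix_exp_neg_le {p x : ℝ} (hp : 0 < p) (hp1 : p ≤ 1) (hx : 0 ≤ x) :
    log (1 - p + p * exp (-x)) ≤ -(p * x) + x ^ 2 * min (p / 2) (1 / 8) := by
  have h0 : 0 < 1 - p + p * exp (-x) := by
    have := mul_pos hp (exp_pos (-x)); linarith
  rw [mul_min_of_nonneg _ _ (sq_nonneg x), ← min_add_add_left, le_min_iff]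
  constructor
  · rw [log_le_iff_le_exp h0]
    convert mix_exp_neg_le hp.le hx using 2; ring
  · rw [log_le_iff_le_exp h0]
    convert mix_exp_neg_le_hoeffding hp.le hp1 x using 2; ring

variable {K : ℕ}

/-- The exponential weights potential: normalized log-mean-exp of the negative losses. -/
noncomputable def logMeanExp (η : ℝ) (Z : Fin K → ℝ) : ℝ :=
  1 / η * log ((∑ j, exp (-η * Z j)) / K)

theorem sum_exp_pos [NeZero K] (η : ℝ) (Z : Fin K → ℝ) : 0 < ∑ j, exp (-η * Z j) :=
  Finset.sum_pos (fun _ _ => exp_pos _) Finset.univ_nonempty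

theorem expWeights_pos [NeZero K] (η : ℝ) (Z : Fin K → ℝ) (i : Fin K) : 0 < expWeights η Z i :=
  div_pos (exp_pos _) (sum_exp_pos η Z)

theorem sum_expWeights [NeZero K] (η : ℝ) (Z : Fin K → ℝ) : ∑ i, expWeights η Z i = 1 := by
  unfold expWeights
  rw [← Finset.sum_div, div_self (sum_exp_pos η Z).ne']

theorem expWeights_le_one [NeZero K] (η : ℝ) (Z : Fin K → ℝ) (i : Fin K) :
    expWeights η Z i ≤ 1 := by
  rw [← sum_expWeights η Z]
  exact Finset.single_le_sum (fun j _ => (expWeights_pos η Z j).le) (Finset.mem_univ i)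

/-- Only one loss estimate moves per round, so the ratio of the exponential sums is the Laplace
transform of a Bernoulli variable scaled by `d`. -/
theorem logMeanExp_add_single [NeZero K] (η : ℝ) (Z : Fin K → ℝ) (i : Fin K) (d : ℝ) :
    logMeanExp η (fun j => Z j + if j = i then d else 0) - logMeanExp η Z =
      1 / η * log (1 - expWeights η Z i + expWeights η Z i * exp (-(η * d))) := by
  have hK : (0 : ℝ) < K := by exact_mod_cast Nat.pos_of_neZero K
  have hS := sum_exp_pos η Z
  have hsum : ∑ j, exp (-η * (Z j + if j = i then d else 0)) =
      (∑ j, exp (-η * Z j)) * (1 - expWeights η Z i + expWeights η Z i * exp (-(η * d))) := by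
    have e : ∀ j, exp (-η * (Z j + if j = i then d else 0)) = exp (-η * Z j) +
        if j = i then exp (-η * Z j) * (exp (-(η * d)) - 1) else 0 := by
      intro j
      split_ifs
      · rw [show -η * (Z j + d) = -η * Z j + -(η * d) by ring, exp_add]; ring
      · simp
    rw [Finset.sum_congr rfl fun j _ => e j, Finset.sum_add_distrib, Finset.sum_ite_eq']
    simp only [Finset.mem_univ, if_true, expWeights]
    field_simp
    ring
  have hpos : 0 < ∑ j, exp (-η * (Z j + if j = i then d else 0)) := sum_exp_pos _ _
  rw [logMeanExp, logMeanExp, ← mul_sub, ← log_div (by positivity) (by positivity), hsum]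
  congr 2
  field_simp

/-- The power mean inequality with exponent `η / η' ≥ 1`. It makes a decreasing learning rate
harmless. -/
theorem logMeanExp_mono [NeZero K] {η η' : ℝ} (hη' : 0 < η') (h : η' ≤ η) (Z : Fin K → ℝ) :
    logMeanExp η' Z ≤ logMeanExp η Z := by
  have hK : (0 : ℝ) < K := by exact_mod_cast Nat.pos_of_neZero K
  have hη : 0 < η := hη'.trans_le h
  have key := Real.rpow_arith_mean_le_arith_mean_rpow Finset.univ (fun _ : Fin K => (1 : ℝ) / K)
    (fun j => exp (-η' * Z j)) (fun _ _ => by positivity) (by simp [hK.ne'])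
    (fun _ _ => (exp_pos _).le) (p := η / η') ((one_le_div hη').2 h)
  have e : ∀ j, exp (-η' * Z j) ^ (η / η') = exp (-η * Z j) := by
    intro j
    rw [← exp_mul]; congr 1; field_simp
  simp only [e, ← Finset.mul_sum] at key
  have hS := sum_exp_pos η Z
  have hS' := sum_exp_pos η' Z
  have := log_le_log (by positivity) key
  rw [log_rpow (by positivity), one_div_mul_eq_div, one_div_mul_eq_div] at this
  rw [logMeanExp, logMeanExp, one_div_mul_eq_div, one_div_mul_eq_div, le_div_iff₀ hη]
  calc _ = η / η' * log ((∑ j, exp (-η' * Z j)) / K) := by ring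
    _ ≤ _ := this

/-- Keep only the `i`-th term of the sum. This is the price of competing with arm `i`. -/
theorem neg_le_logMeanExp_add [NeZero K] {η : ℝ} (hη : 0 < η) (Z : Fin K → ℝ) (i : Fin K) :
    -(log K / η) ≤ logMeanExp η Z + Z i := by
  have hK : (0 : ℝ) < K := by exact_mod_cast Nat.pos_of_neZero K
  have h1 : exp (-η * Z i) ≤ ∑ j, exp (-η * Z j) :=
    Finset.single_le_sum (f := fun j => exp (-η * Z j)) (fun _ _ => (exp_pos _).le)
      (Finset.mem_univ i)
  have h2 := log_le_log (exp_pos _) h1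
  rw [log_exp] at h2
  rw [logMeanExp, log_div (sum_exp_pos η Z).ne' hK.ne', ← sub_nonneg]
  have : 1 / η * (log (∑ j, exp (-η * Z j)) - log K) + Z i - -(log K / η) =
      (log (∑ j, exp (-η * Z j)) + η * Z i) / η := by field_simp; ring
  rw [this]
  apply div_nonneg _ hη.le
  linarith

/-- The second order coefficient in the analysis of exponential weights with `K` arms. -/
noncomputable def varianceFactor (K : ℕ) : ℝ := if K = 2 then 3 / 2 else K

/-- With two arms, one has probability at least `1/2` and its term is at most `1/2`, so `2` improves
to `3/2`. -/
theorem sum_min_le_varianceFactor (p : Fin K → ℝ) (hp : ∀ i, 0 < p i) (hsum : ∑ i, p i = 1) :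
    ∑ i, min 1 (1 / (4 * p i)) ≤ varianceFactor K := by
  unfold varianceFactor
  split_ifs with h
  · subst h
    rw [Fin.sum_univ_two] at hsum ⊢
    have h0 := hp 0
    have h1 := hp 1
    have aux : ∀ q : ℝ, 1 / 2 ≤ q → 1 / (4 * q) ≤ 1 / 2 := by
      intro q hq
      rw [div_le_div_iff₀ (by linarith) (by norm_num)]; linarith
    rcases le_total (1 / 2) (p 0) with h | h
    · linarith [min_le_right 1 (1 / (4 * p 0)), min_le_left 1 (1 / (4 * p 1)), aux _ h]
    · linarith [min_le_right 1 (1 / (4 * p 1)), min_le_left 1 (1 / (4 * p 0)),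
        aux (p 1) (by linarith)]
  · calc ∑ i, min 1 (1 / (4 * p i)) ≤ ∑ _i : Fin K, (1 : ℝ) :=
          Finset.sum_le_sum fun i _ => min_le_left _ _
      _ = K := by simp

/-- One step of exponential weights with importance weighted losses, in expectation. -/
theorem sum_expWeights_mul_logMeanExp_le [NeZero K] {η : ℝ} (hη : 0 < η) (Z z : Fin K → ℝ)
    (hz : ∀ i, 0 ≤ z i) (hz1 : ∀ i, z i ≤ 1) :
    ∑ i, expWeights η Z i *
        (logMeanExp η (fun j => Z j + if j = i then z i / expWeights η Z i else 0) -
          logMeanExp η Z) ≤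
      -∑ i, expWeights η Z i * z i + η / 2 * varianceFactor K := by
  have key : ∀ i, expWeights η Z i *
        (logMeanExp η (fun j => Z j + if j = i then z i / expWeights η Z i else 0) -
          logMeanExp η Z) ≤
      -(expWeights η Z i * z i) + η / 2 * min 1 (1 / (4 * expWeights η Z i)) := by
    intro i
    rw [logMeanExp_add_single]
    have hp := expWeights_pos η Z i
    have hp1 := expWeights_le_one η Z i
    generalize expWeights η Z i = p at *
    have h := log_mix_exp_neg_le hp hp1 (x := η * (z i / p)) (by have := hz i; positivity)
    calc p * (1 / η * log (1 - p + p * exp (-(η * (z i / p)))))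
        ≤ p * (1 / η * (-(p * (η * (z i / p))) + (η * (z i / p)) ^ 2 * min (p / 2) (1 / 8))) := by
          gcongr
      _ = -(p * z i) + z i ^ 2 * (η / p * min (p / 2) (1 / 8)) := by
          field_simp
      _ ≤ -(p * z i) + 1 * (η / p * min (p / 2) (1 / 8)) := by
          gcongr
          exact pow_le_one₀ (hz i) (hz1 i)
      _ = _ := by
          rw [one_mul, mul_min_of_nonneg _ _ (by positivity), mul_min_of_nonneg _ _ (by positivity)]
          congr 2 <;> field_simp
          norm_num
  calc _ ≤ ∑ i, (-(expWeights η Z i * z i) + η / 2 * min 1 (1 / (4 * expWeights η Z i))) :=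
        Finset.sum_le_sum fun i _ => key i
    _ = -∑ i, expWeights η Z i * z i +
          η / 2 * ∑ i, min 1 (1 / (4 * expWeights η Z i)) := by
        rw [Finset.sum_add_distrib, Finset.sum_neg_distrib, Finset.mul_sum]
    _ ≤ _ := by
        gcongr
        exact sum_min_le_varianceFactor _ (expWeights_pos η Z) (sum_expWeights η Z)

end ExpWeights

/-! ### Optional stopping along a run -/

section Run

variable {X Ω : Type*} {K : ℕ} [MeasurableSpace Ω]

/-- Optional stopping for a function of the history that decreases on average in each round. -/
theorem IsRun.integral_stopped_le {μ : Measure Ω} [IsProbabilityMeasure μ] {ν : Config X K}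
    {g : List X → X} {eos : X} {pt : List X} {alg : ArmAlg X K} {I : ℕ → Ω → Fin K}
    (hI : IsRun ν g eos pt alg μ I) (hfin : canonicalLength g eos pt ≠ ⊤) (f : History X K → ℝ)
    (hstep : ∀ a t, t < rounds ν g eos pt a →
      ∑ i, alg (history ν g pt a t) i *
        f ((i, specDecSub ν g i (t + 1) (currentPrompt pt (history ν g pt a t))) ::
          history ν g pt a t) ≤ f (history ν g pt a t)) :
    Integrable (fun ω => f (history ν g pt (fun t => I t ω)
      (rounds ν g eos pt fun t => I t ω))) μ ∧
    ∫ ω, f (history ν g pt (fun t => I t ω) (rounds ν g eos pt fun t => I t ω)) ∂μ ≤ f [] := by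
  have : Nonempty Ω := nonempty_of_isProbabilityMeasure μ
  set F : Ω → ℝ := fun ω => f (history ν g pt (fun t => I t ω)
      (rounds ν g eos pt fun t => I t ω)) with hF
  have hmeas : ∀ (a : ℕ → Fin K) (t : ℕ), MeasurableSet {ω | ∀ s < t, I s ω = a s} := by
    intro a t
    simp only [Set.ofPred_forall]
    exact MeasurableSet.iInter fun s => MeasurableSet.iInter fun _ =>
      hI.measurable s (measurableSet_singleton (a s))
  have main : ∀ (n : ℕ) (a : ℕ → Fin K) (t : ℕ), (canonicalLength g eos pt).toNat ≤ t + n →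
      t ≤ rounds ν g eos pt a →
      IntegrableOn F {ω | ∀ s < t, I s ω = a s} μ ∧
      ∫ ω in {ω | ∀ s < t, I s ω = a s}, F ω ∂μ ≤
        μ.real {ω | ∀ s < t, I s ω = a s} * f (history ν g pt a t) := by
    intro n
    induction n with
    | zero =>
      intro a t hn ht
      have hta : rounds ν g eos pt a = t := le_antisymm ((rounds_le ν hfin a).trans hn) ht
      have hEq : Set.EqOn F (fun _ => f (history ν g pt a t)) {ω | ∀ s < t, I s ω = a s} := by
        intro ω hω
        have hω' : ∀ s < t, a s = I s ω := fun s hs => (hω s hs).symm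
        simp only [hF]
        rw [rounds_congr_of_le ν hfin hω' hta, history_congr ν g pt hω']
      refine ⟨(integrableOn_congr_fun hEq (hmeas a t)).2 (integrable_const _), ?_⟩
      rw [setIntegral_congr_fun (hmeas a t) hEq]
      simp
    | succ n ih =>
      intro a t hn ht
      rcases ht.eq_or_lt with hta | hta
      · have hEq : Set.EqOn F (fun _ => f (history ν g pt a t)) {ω | ∀ s < t, I s ω = a s} := by
          intro ω hω
          have hω' : ∀ s < t, a s = I s ω := fun s hs => (hω s hs).symm
          simp only [hF]
          rw [rounds_congr_of_le ν hfin hω' hta.symm, history_congr ν g pt hω']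
        refine ⟨(integrableOn_congr_fun hEq (hmeas a t)).2 (integrable_const _), ?_⟩
        rw [setIntegral_congr_fun (hmeas a t) hEq]
        simp
      -- The cylinder splits according to the arm of round `t + 1`; being alive at time `t` depends
      -- only on earlier arms, so the law of the run applies to every piece.
      · let b : Fin K → ℕ → Fin K := fun i => Function.update a t i
        have hb : ∀ i, ∀ s < t, b i s = a s := fun i s hs => by simp [b, hs.ne]
        have hbt : ∀ i, b i t = i := fun i => by simp [b]
        have hrounds : ∀ i, t < rounds ν g eos pt (b i) := by
          intro i
          rwa [lt_rounds_iff ν hfin, history_congr ν g pt (hb i), ← lt_rounds_iff ν hfin]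
        have hU : {ω | ∀ s < t, I s ω = a s} = ⋃ i, {ω | ∀ s < t + 1, I s ω = b i s} := by
          ext ω
          simp only [Set.mem_ofPred_eq, Set.mem_iUnion]
          constructor
          · intro h
            refine ⟨I t ω, fun s hs => ?_⟩
            rcases (Nat.lt_succ_iff.1 hs).eq_or_lt with rfl | hs
            · rw [hbt]
            · rw [hb _ s hs, h s hs]
          · rintro ⟨i, h⟩ s hs
            rw [h s (by omega), hb _ s hs]
        have hdisj : Pairwise (Function.onFun Disjoint
            fun i => {ω | ∀ s < t + 1, I s ω = b i s}) := by
          intro i j hij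
          refine Set.disjoint_left.2 fun ω h1 h2 => hij ?_
          rw [← hbt i, ← hbt j, ← h1 t (by omega), ← h2 t (by omega)]
        have hi := fun i => ih (b i) (t + 1) (by omega) (hrounds i)
        have hmass : ∀ i, μ.real {ω | ∀ s < t + 1, I s ω = b i s} =
            μ.real {ω | ∀ s < t, I s ω = a s} * alg (history ν g pt a t) i := by
          intro i
          have h := hI.law (b i) t (by rw [← coe_rounds ν hfin]; exact_mod_cast hrounds i)
          simp only [← Nat.lt_succ_iff] at h
          rw [history_congr ν g pt (hb i), hbt] at h
          rw [h]
          congr 2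
          ext ω
          exact forall₂_congr fun s hs => by rw [hb i s hs]
        have hhist : ∀ i, history ν g pt (b i) (t + 1) =
            (i, specDecSub ν g i (t + 1) (currentPrompt pt (history ν g pt a t))) ::
              history ν g pt a t := by
          intro i
          rw [history, history_congr ν g pt (hb i), hbt]
        rw [hU]
        refine ⟨integrableOn_finite_iUnion.2 fun i => (hi i).1, ?_⟩
        rw [integral_iUnion_fintype (fun i => hmeas (b i) (t + 1)) hdisj fun i => (hi i).1, ← hU]
        calc _ ≤ ∑ i, μ.real {ω | ∀ s < t + 1, I s ω = b i s} *
                  f (history ν g pt (b i) (t + 1)) := Finset.sum_le_sum fun i _ => (hi i).2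
          _ = μ.real {ω | ∀ s < t, I s ω = a s} * ∑ i, alg (history ν g pt a t) i *
                f ((i, specDecSub ν g i (t + 1) (currentPrompt pt (history ν g pt a t))) ::
                  history ν g pt a t) := by
              rw [Finset.mul_sum]
              exact Finset.sum_congr rfl fun i _ => by rw [hmass, hhist, mul_assoc]
          _ ≤ _ := mul_le_mul_of_nonneg_left (hstep a t hta) measureReal_nonneg
  have h := main (canonicalLength g eos pt).toNat (fun t => I t (Classical.arbitrary Ω)) 0
    (by omega) (Nat.zero_le _)
  simpa [history] using h

end Run

/-! ### The compensated regret of EXP3Spec and its constants -/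

section Potential

variable {X : Type*} {K : ℕ}

/-- The regret of a history against the fixed arm `i₀` with lengths `y i₀`, compensated to
decrease on average under EXP3Spec. -/
noncomputable def exp3Potential (L : ℕ) (y₀ : ℕ → ℕ) (i₀ : Fin K) (h : History X K) : ℝ :=
  ((∑ s ∈ Finset.range h.length, (y₀ (s + 1) : ℝ)) - generated h) / L -
    varianceFactor K / 2 * ∑ s ∈ Finset.range h.length, learningRate K (s + 1) +
    (logMeanExp (learningRate K h.length) (exp3Loss L h) + exp3Loss L h i₀)

/-- The rate at round `0` is a division by zero, hence `0`, and so is the log-mean-exp term. -/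
theorem exp3Potential_nil (L : ℕ) (y₀ : ℕ → ℕ) (i₀ : Fin K) :
    exp3Potential L y₀ i₀ ([] : History X K) = 0 := by
  simp [exp3Potential, generated, logMeanExp, exp3Loss, learningRate]

theorem log_pos_of_two_le (hK : 2 ≤ K) : 0 < Real.log K :=
  Real.log_pos (by exact_mod_cast hK)

theorem learningRate_pos (hK : 2 ≤ K) {t : ℕ} (ht : 0 < t) : 0 < learningRate K t := by
  have h1 := log_pos_of_two_le hK
  have h2 : (0 : ℝ) < K := by exact_mod_cast (by omega : 0 < K)
  have h3 : (0 : ℝ) < t := by exact_mod_cast ht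
  exact Real.sqrt_pos.2 (by positivity)

theorem learningRate_succ_le (hK : 2 ≤ K) {t : ℕ} (ht : 0 < t) :
    learningRate K (t + 1) ≤ learningRate K t := by
  have h1 := log_pos_of_two_le hK
  have h2 : (0 : ℝ) < K := by exact_mod_cast (by omega : 0 < K)
  have h3 : (0 : ℝ) < t := by exact_mod_cast ht
  unfold learningRate
  gcongr
  simp

/-- Token regret over `L` grows by `z i - z i₀`. On average, the first-order drop of the
log-mean-exp cancels `z i`, the unbiased estimate of the loss of `i₀` cancels `-z i₀`, and the
subtracted learning rate pays for the second-order term. -/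
theorem exp3Potential_step [NeZero K] (hK : 2 ≤ K) {L : ℕ} (hL : 1 ≤ L) (y₀ : ℕ → ℕ)
    (i₀ : Fin K) (h : History X K) (x : Fin K → List X)
    (hx1 : ∀ i, 1 ≤ (x i).length) (hxL : ∀ i, (x i).length ≤ L + 1)
    (hx₀ : (x i₀).length = y₀ (h.length + 1)) :
    ∑ i, exp3Spec L h i * exp3Potential L y₀ i₀ ((i, x i) :: h) ≤ exp3Potential L y₀ i₀ h := by
  have hL0 : (0 : ℝ) < L := by exact_mod_cast hL
  set η := learningRate K (h.length + 1) with hηdef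
  have hη : 0 < η := learningRate_pos hK (by omega)
  set Z := exp3Loss L h with hZ
  set z : Fin K → ℝ := fun i => ((L : ℝ) + 1 - (x i).length) / L with hz
  have hz0 : ∀ i, 0 ≤ z i := fun i => by
    have : ((x i).length : ℝ) ≤ L + 1 := by exact_mod_cast hxL i
    exact div_nonneg (by linarith) hL0.le
  have hz1 : ∀ i, z i ≤ 1 := fun i => by
    have : (1 : ℝ) ≤ (x i).length := by exact_mod_cast hx1 i
    exact (div_le_one hL0).2 (by linarith)
  set p := expWeights η Z with hp
  have hppos : ∀ i, 0 < p i := expWeights_pos η Z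
  have hpsum : ∑ i, p i = 1 := sum_expWeights η Z
  have hloss : ∀ i, exp3Loss L ((i, x i) :: h) =
      fun j => Z j + if j = i then z i / p i else 0 := by
    intro i
    funext j
    simp only [exp3Loss]
    congr 1
    split_ifs with hji
    · subst hji
      simp only [hz, hp, div_div]; rfl
    · rfl
  -- The potential carries the rate of the last completed round, so it is first moved to the current
  -- rate. For the empty history both sides vanish.
  have hmono : logMeanExp η Z ≤ logMeanExp (learningRate K h.length) Z := by
    rcases h with _ | ⟨r, h⟩
    · simp [hZ, logMeanExp, exp3Loss, learningRate]
    · exact logMeanExp_mono hη (learningRate_succ_le hK (by simp)) Z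
  have hle : ∀ i, exp3Potential L y₀ i₀ ((i, x i) :: h) ≤ exp3Potential L y₀ i₀ h +
      (z i - z i₀) - varianceFactor K / 2 * η +
      (logMeanExp η (fun j => Z j + if j = i then z i / p i else 0) - logMeanExp η Z) +
      if i₀ = i then z i / p i else 0 := by
    intro i
    have hzz : z i - z i₀ = ((y₀ (h.length + 1) : ℝ) - (x i).length) / L := by
      simp only [hz, hx₀]; field_simp; ring
    unfold exp3Potential
    rw [hloss i, hzz]
    simp only [List.length_cons, Finset.sum_range_succ, generated, Nat.cast_add, ← hηdef, ← hZ]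
    have e : ∀ A B C D : ℝ, (A + B - (C + D)) / L = (A - C) / L + (B - D) / L := by
      intros; ring
    rw [e, mul_add]
    linarith
  have hstep := sum_expWeights_mul_logMeanExp_le hη Z z hz0 hz1
  rw [← hp] at hstep
  calc ∑ i, exp3Spec L h i * exp3Potential L y₀ i₀ ((i, x i) :: h)
      ≤ ∑ i, p i * (exp3Potential L y₀ i₀ h +
      (z i - z i₀) - varianceFactor K / 2 * η +
      (logMeanExp η (fun j => Z j + if j = i then z i / p i else 0) - logMeanExp η Z) +
      if i₀ = i then z i / p i else 0) :=
        Finset.sum_le_sum fun i _ => mul_le_mul_of_nonneg_left (hle i) (hppos i).le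
    _ = ∑ i, ((exp3Potential L y₀ i₀ h - z i₀ - varianceFactor K / 2 * η) * p i + p i * z i +
          p i * (logMeanExp η (fun j => Z j + if j = i then z i / p i else 0) - logMeanExp η Z) +
          if i₀ = i then z i else 0) := by
        refine Finset.sum_congr rfl fun i _ => ?_
        have : p i * (if i₀ = i then z i / p i else 0) = if i₀ = i then z i else 0 := by
          split_ifs
          · rw [mul_div_cancel₀ _ (hppos i).ne']
          · simp
        rw [← this]; ring
    _ = exp3Potential L y₀ i₀ h - varianceFactor K / 2 * η + ∑ i, p i * z i +
          ∑ i, p i * (logMeanExp η (fun j => Z j + if j = i then z i / p i else 0) -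
            logMeanExp η Z) := by
        simp only [Finset.sum_add_distrib, ← Finset.mul_sum, hpsum, Finset.sum_ite_eq,
          Finset.mem_univ, if_true]
        ring
    _ ≤ _ := by linarith

/-- `∑_{s ≤ n} s^{-1/2} ≤ 2 √n - 6/5` for `n ≥ 4`. -/
theorem sum_inv_sqrt_le {n : ℕ} (hn : 4 ≤ n) :
    ∑ s ∈ Finset.range n, 1 / Real.sqrt ((s : ℝ) + 1) ≤ 2 * Real.sqrt n - 6 / 5 := by
  induction n, hn using Nat.le_induction with
  -- The sum is about `2.7845`, just below `4 - 6/5`; the inequality fails at `n = 3`.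
  | base =>
    have h2 : 1 / Real.sqrt 2 ≤ 0.7072 := by
      rw [div_le_iff₀ (by positivity)]
      have : (1.4142 : ℝ) ≤ √2 := Real.le_sqrt_of_sq_le (by norm_num)
      linarith
    have h3 : 1 / Real.sqrt 3 ≤ 0.5775 := by
      rw [div_le_iff₀ (by positivity)]
      have : (1.732 : ℝ) ≤ √3 := Real.le_sqrt_of_sq_le (by norm_num)
      linarith
    have h4 : Real.sqrt 4 = 2 := by
      rw [show (4 : ℝ) = 2 ^ 2 by norm_num]; exact Real.sqrt_sq (by norm_num)
    simp only [Finset.sum_range_succ, Finset.sum_range_zero]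
    norm_num [h4] at h2 h3 ⊢
    linarith
  | succ n hn ih =>
    rw [Finset.sum_range_succ]
    push_cast
    have h1 : 0 < √((n : ℝ) + 1) := Real.sqrt_pos.2 (by positivity)
    have h2 : √((n : ℝ) + 1) ^ 2 = n + 1 := Real.sq_sqrt (by positivity)
    have h3 : √(n : ℝ) ^ 2 = n := Real.sq_sqrt (by positivity)
    have : 1 / √((n : ℝ) + 1) ≤ 2 * √((n : ℝ) + 1) - 2 * √n := by
      rw [div_le_iff₀ h1]
      nlinarith [sq_nonneg (√((n : ℝ) + 1) - √n)]
    linarith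

theorem learningRate_eq (hK : 2 ≤ K) (s : ℕ) :
    learningRate K (s + 1) = √(K * Real.log K) / K * (1 / √((s : ℝ) + 1)) := by
  have h1 := log_pos_of_two_le hK
  have h2 : (0 : ℝ) < K := by exact_mod_cast (by omega : 0 < K)
  have e : Real.log K / ((s + 1 : ℕ) * K) = (K * Real.log K) / (K ^ 2 * ((s : ℝ) + 1)) := by
    push_cast; field_simp
  rw [learningRate, e, Real.sqrt_div (by positivity), Real.sqrt_mul (sq_nonneg (K : ℝ)),
    Real.sqrt_sq h2.le]
  ring

theorem log_div_learningRate (hK : 2 ≤ K) {t : ℕ} (ht : 0 < t) :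
    Real.log K / learningRate K t = √(t * (K * Real.log K)) := by
  have h1 := log_pos_of_two_le hK
  have h2 : (0 : ℝ) < K := by exact_mod_cast (by omega : 0 < K)
  have h3 : (0 : ℝ) < t := by exact_mod_cast ht
  have h4 := learningRate_pos hK ht
  rw [eq_comm, Real.sqrt_eq_iff_mul_self_eq (by positivity) (by positivity)]
  rw [div_mul_div_comm, learningRate, Real.mul_self_sqrt (by positivity)]
  field_simp

/-- The regret bound of the anytime EXP3 algorithm leaves room for one extra round. -/
theorem exp3_bound_add_one_le (hK : 2 ≤ K) {n : ℕ} (hn : 4 ≤ n) :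
    varianceFactor K / 2 * ∑ s ∈ Finset.range n, learningRate K (s + 1) +
      √(n * (K * Real.log K)) + 1 ≤ 2 * √(n * (K * Real.log K)) := by
  have h1 := log_pos_of_two_le hK
  have h2 : (0 : ℝ) < K := by exact_mod_cast (by omega : 0 < K)
  have hS := sum_inv_sqrt_le hn
  have hn2 : 2 ≤ √(n : ℝ) := Real.le_sqrt_of_sq_le (by norm_num; exact_mod_cast hn)
  simp only [learningRate_eq hK, ← Finset.mul_sum]
  rw [Real.sqrt_mul (Nat.cast_nonneg n)]
  set c := √(K * Real.log K) with hc
  have hc0 : 0 ≤ c := Real.sqrt_nonneg _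
  set S := ∑ s ∈ Finset.range n, 1 / Real.sqrt ((s : ℝ) + 1)
  by_cases h : K = 2
  -- Here the slack is `c √n / 4 + 0.45 c ≥ 0.95 c`, which exceeds `1`. The factor `2` in place of
  -- `3/2` would leave only `0.6 c`, about `0.71`.
  · have hc1 : 1.1 ≤ c := by
      apply Real.le_sqrt_of_sq_le
      have := Real.log_two_gt_d9
      subst h; norm_num; linarith
    have e : varianceFactor K / 2 * (c / K * S) = 3 / 8 * (c * S) := by
      rw [varianceFactor, if_pos h, h]; push_cast; ring
    have := mul_le_mul_of_nonneg_left hS hc0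
    rw [e]
    nlinarith [mul_le_mul_of_nonneg_left hn2 hc0]
  -- The slack is `0.6 c`, and `0.6 * 1.7 > 1`.
  · have hc1 : 1.7 ≤ c := by
      apply Real.le_sqrt_of_sq_le
      have h3 : (3 : ℝ) ≤ K := by exact_mod_cast (by omega : 3 ≤ K)
      have : 1 ≤ Real.log K := by
        rw [Real.le_log_iff_exp_le h2]
        exact (Real.exp_one_lt_d9.le.trans (by norm_num)).trans h3
      nlinarith
    have e : varianceFactor K / 2 * (c / K * S) = 1 / 2 * (c * S) := by
      rw [varianceFactor, if_neg h]; field_simp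
    have := mul_le_mul_of_nonneg_left hS hc0
    rw [e]
    linarith

end Potential

/-! ### From token regret to stopping time regret -/

section Regret

variable {X Ω : Type*} {K : ℕ} [MeasurableSpace Ω]

/-- Optional stopping applied to minus the number of rounds, for its integrability conclusion only.
-/
theorem IsRun.integrable_rounds [NeZero K] {μ : Measure Ω} [IsProbabilityMeasure μ]
    {ν : Config X K} {g : List X → X} {eos : X} {pt : List X} {I : ℕ → Ω → Fin K}
    (hI : IsRun ν g eos pt (exp3Spec ν.L) μ I) (hfin : canonicalLength g eos pt ≠ ⊤) :
    Integrable (fun ω => (rounds ν g eos pt (fun t => I t ω) : ℝ)) μ := by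
  have h := (hI.integral_stopped_le hfin (fun h => -(h.length : ℝ)) (fun a t _ => by
    simp only [List.length_cons]
    rw [← Finset.sum_mul]
    unfold exp3Spec
    rw [sum_expWeights]
    push_cast
    linarith)).1.neg
  simpa [length_history] using! h

/-- A path that is slower than the arm `i₀` has a number of rounds controlled by the
compensated regret. -/
theorem rounds_sub_le_exp3Potential [NeZero K] (hK : 2 ≤ K) {ν : Config X K} (hL : 1 ≤ ν.L)
    {g : List X → X} {eos : X} {pt : List X} (hfin : canonicalLength g eos pt ≠ ⊤)
    {y : Fin K → ℕ → ℕ} (hy : ObliviousLengths ν g eos pt y) (a : ℕ → Fin K) (i₀ : Fin K)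
    (h4 : 4 ≤ rounds ν g eos pt (fun _ => i₀))
    (hle : rounds ν g eos pt (fun _ => i₀) ≤ rounds ν g eos pt a) :
    (rounds ν g eos pt a : ℝ) - rounds ν g eos pt (fun _ => i₀) ≤
      ν.L * (exp3Potential ν.L (y i₀) i₀ (history ν g pt a (rounds ν g eos pt a)) +
        2 * √(rounds ν g eos pt a * (K * Real.log K))) := by
  have hL0 : (0 : ℝ) < ν.L := by exact_mod_cast hL
  have h1 := rounds_add_generated_le ν hfin hy a i₀ hle
  generalize rounds ν g eos pt (fun _ => i₀) = S at *
  generalize rounds ν g eos pt a = T at *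
  have h2 := exp3_bound_add_one_le hK (h4.trans hle)
  have h3 := neg_le_logMeanExp_add (learningRate_pos hK (t := T) (by omega))
    (exp3Loss ν.L (history ν g pt a T)) i₀
  rw [log_div_learningRate hK (by omega)] at h3
  have h5 : (T : ℝ) - S ≤ ν.L * (((∑ s ∈ Finset.range T, (y i₀ (s + 1) : ℝ)) -
      generated (history ν g pt a T)) / ν.L + 1) := by
    rw [mul_add, mul_div_cancel₀ _ hL0.ne']
    have : (T : ℝ) + generated (history ν g pt a T) ≤
      S + ∑ s ∈ Finset.range T, (y i₀ (s + 1) : ℝ) + ν.L := by exact_mod_cast h1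
    linarith
  refine h5.trans (mul_le_mul_of_nonneg_left ?_ hL0.le)
  unfold exp3Potential
  rw [length_history]
  linarith

/-- The self-bounding form of the regret bound. -/
theorem IsRun.integral_rounds_sub_le [NeZero K] (hK : 2 ≤ K) {μ : Measure Ω}
    [IsProbabilityMeasure μ] {ν : Config X K} (hL : 1 ≤ ν.L) {g : List X → X} {eos : X}
    {pt : List X} (hfin : canonicalLength g eos pt ≠ ⊤)
    {y : Fin K → ℕ → ℕ} (hy : ObliviousLengths ν g eos pt y) {I : ℕ → Ω → Fin K}
    (hI : IsRun ν g eos pt (exp3Spec ν.L) μ I) (i₀ : Fin K)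
    (hlate : ∀ᵐ ω ∂μ, rounds ν g eos pt (fun _ => i₀) ≤ rounds ν g eos pt (fun t => I t ω)) :
    ∫ ω, (rounds ν g eos pt (fun t => I t ω) : ℝ) ∂μ - rounds ν g eos pt (fun _ => i₀) ≤
      2 * ν.L * √((∫ ω, (rounds ν g eos pt (fun t => I t ω) : ℝ) ∂μ) *
        (K * Real.log K)) := by
  have hL1 : (1 : ℝ) ≤ ν.L := by exact_mod_cast hL
  have hlog := log_pos_of_two_le hK
  have hK2 : (2 : ℝ) ≤ K := by exact_mod_cast hK
  have hc1 : 1 ≤ K * Real.log K := by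
    have := Real.log_two_gt_d9
    have := Real.log_le_log (by norm_num) hK2
    nlinarith
  have hint := hI.integrable_rounds hfin
  have hS1 := rounds_pos ν hfin (fun _ => i₀)
  have hT := fun a : ℕ → Fin K => rounds_le ν hfin a
  have hN := canonicalLength_le_mul_rounds ν hfin (fun _ => i₀)
  have hpath := rounds_sub_le_exp3Potential hK hL hfin hy (i₀ := i₀)
  obtain ⟨hpint, hpot⟩ := hI.integral_stopped_le hfin (exp3Potential ν.L (y i₀) i₀)
    (fun a t ht => by
      refine exp3Potential_step hK hL _ _ _
        (fun i => specDecSub ν g i (t + 1) (currentPrompt pt (history ν g pt a t)))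
        (fun i => (length_specDecSub ν g pt a t i).1)
        (fun i => (length_specDecSub ν g pt a t i).2) ?_
      rw [length_history]
      exact hy a t (by rw [← coe_rounds ν hfin]; exact_mod_cast ht) i₀)
  rw [exp3Potential_nil] at hpot
  set E := ∫ ω, (rounds ν g eos pt (fun t => I t ω) : ℝ) ∂μ with hE
  set S := rounds ν g eos pt (fun _ => i₀)
  set c := K * Real.log K
  have hES : (S : ℝ) ≤ E := by
    calc (S : ℝ) = ∫ _ω, (S : ℝ) ∂μ := by simp
      _ ≤ E := integral_mono_ae (integrable_const _) hint (by
        filter_upwards [hlate] with ω hω using by exact_mod_cast hω)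
  have hS1' : (1 : ℝ) ≤ S := by exact_mod_cast hS1
  by_cases h4 : 4 ≤ S
  -- Jensen's inequality by a tangent: `2 √(T c) ≤ T c / m + m`, and this `m` makes both terms equal
  -- to `m` in expectation.
  · set m := √(E * c) with hm
    have hm0 : 0 < m := Real.sqrt_pos.2 (by nlinarith)
    have hm2 : m ^ 2 = E * c := Real.sq_sqrt (by nlinarith)
    have hae : ∀ᵐ ω ∂μ, (rounds ν g eos pt (fun t => I t ω) : ℝ) - S ≤
        ν.L * (exp3Potential ν.L (y i₀) i₀ (history ν g pt (fun t => I t ω)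
          (rounds ν g eos pt (fun t => I t ω))) +
          ((rounds ν g eos pt (fun t => I t ω) : ℝ) * (c / m) + m)) := by
      filter_upwards [hlate] with ω hω
      refine (hpath _ h4 hω).trans ?_
      gcongr
      set T := (rounds ν g eos pt (fun t => I t ω) : ℝ)
      have hT0 : 0 ≤ T := Nat.cast_nonneg _
      have hq : √(T * c) ^ 2 = T * c := Real.sq_sqrt (by positivity)
      have : T * (c / m) + m = (√(T * c) ^ 2 + m ^ 2) / m := by rw [hq]; field_simp
      rw [this, le_div_iff₀ hm0]
      nlinarith [sq_nonneg (√(T * c) - m)]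
    have h := integral_mono_ae (hint.sub (integrable_const (S : ℝ)))
      ((hpint.add ((hint.mul_const (c / m)).add (integrable_const m))).const_mul (ν.L : ℝ)) hae
    rw [integral_sub' hint (integrable_const _), integral_const_mul, integral_add' hpint
      ((hint.mul_const (c / m)).add (integrable_const m)),
      integral_add' (hint.mul_const (c / m)) (integrable_const m), integral_mul_const] at h
    have e2 : E * (c / m) = m := by rw [← mul_div_assoc, ← hm2]; field_simp
    rw [← hE, e2] at h
    simp only [integral_const, probReal_univ, smul_eq_mul, one_mul] at h
    nlinarith
  -- For `S < 4`: `E - S ≤ L S ≤ 2 L √S ≤ 2 L √(E c)`, using `√S ≤ 2`, `S ≤ E` and `c ≥ 1`.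
  · have hEN : E ≤ (ν.L + 1) * S := by
      calc E ≤ ∫ _ω, ((ν.L + 1) * S : ℝ) ∂μ := integral_mono hint (integrable_const _)
            fun ω => by beta_reduce; exact_mod_cast (hT fun t => I t ω).trans hN
        _ = _ := by simp
    have hS4 : (S : ℝ) ≤ 4 := by exact_mod_cast (by omega : S ≤ 4)
    have h1 : √(S : ℝ) ≤ √(E * c) := Real.sqrt_le_sqrt (by nlinarith)
    have h2 : (S : ℝ) ≤ 2 * √(S : ℝ) := by
      have := Real.sq_sqrt (Nat.cast_nonneg (α := ℝ) S)
      have : √(S : ℝ) ≤ 2 := Real.sqrt_le_iff.2 ⟨by norm_num, by linarith⟩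
      nlinarith [Real.sqrt_nonneg (S : ℝ)]
    nlinarith

end Regret

/-- Solving the quadratic inequality `x ≤ A √(S + x)`. -/
theorem le_sq_add_of_le_mul_sqrt {A S x : ℝ} (hA : 0 ≤ A) (hS : 0 ≤ S)
    (h : x ≤ A * √(S + x)) : x ≤ A ^ 2 + A * √S := by
  by_contra! hlt
  have hx : 0 < x := lt_of_le_of_lt (by positivity) hlt
  have h1 : √(S + x) ^ 2 = S + x := Real.sq_sqrt (by linarith)
  have h2 : √S ^ 2 = S := Real.sq_sqrt hS
  have h3 : x ^ 2 ≤ A ^ 2 * (S + x) := by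
    rw [← h1, ← mul_pow]
    exact pow_le_pow_left₀ hx.le h 2
  have h4 : 0 ≤ A * √S := by positivity
  nlinarith [mul_nonneg (sq_nonneg A) h4]

end BanditSpec

theorem theorem3 {X Ω : Type*} {K : ℕ} [MeasurableSpace Ω] (μ : Measure Ω)
    [IsProbabilityMeasure μ] (ν : BanditSpec.Config X K) (hL : 1 ≤ ν.L)
    (g : List X → X) (hg : BanditSpec.IsGreedy ν.P g) (eos : X) (pt : List X)
    (hfin : BanditSpec.canonicalLength g eos pt ≠ ⊤)
    (y : Fin K → ℕ → ℕ) (hy : BanditSpec.ObliviousLengths ν g eos pt y)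
    (I : ℕ → Ω → Fin K)
    (hI : BanditSpec.IsRun ν g eos pt (BanditSpec.exp3Spec ν.L) μ I)
    (hlate : ∀ᵐ ω ∂μ, BanditSpec.bestFixedStoppingTime ν g eos pt ≤
      BanditSpec.stoppingTime ν g eos pt (fun t => I t ω)) :
    BanditSpec.bestFixedStoppingTime ν g eos pt ≠ ⊤ ∧
    BanditSpec.expectedStoppingTime ν g eos pt μ I ≠ ⊤ ∧
    BanditSpec.regret ν g eos pt μ I ≤
      2 * (ν.L : ℝ) *
        min (Real.sqrt (((BanditSpec.canonicalLength g eos pt).toNat : ℝ) * K * Real.log K))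
          (2 * (ν.L : ℝ) * K * Real.log K +
            Real.sqrt (((BanditSpec.bestFixedStoppingTime ν g eos pt).toNat : ℝ) *
              K * Real.log K)) := by
  have : Nonempty Ω := nonempty_of_isProbabilityMeasure μ
  have hne : NeZero K := ⟨by rintro rfl; exact (I 0 (Classical.arbitrary Ω)).elim0⟩
  obtain ⟨i₀, hi₀⟩ := exists_eq_ciInf_of_finite
    (f := fun i : Fin K => BanditSpec.stoppingTime ν g eos pt (fun _ => i))
  have hbest : BanditSpec.bestFixedStoppingTime ν g eos pt =
      (BanditSpec.rounds ν g eos pt (fun _ => i₀) : ℕ∞) := by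
    rw [BanditSpec.coe_rounds ν hfin]; exact hi₀.symm
  have hint := hI.integrable_rounds hfin
  have hexp : BanditSpec.expectedStoppingTime ν g eos pt μ I =
      ENNReal.ofReal (∫ ω, (BanditSpec.rounds ν g eos pt (fun t => I t ω) : ℝ) ∂μ) := by
    rw [ofReal_integral_eq_lintegral_ofReal hint (Filter.Eventually.of_forall fun ω => by simp)]
    refine lintegral_congr fun ω => ?_
    rw [← BanditSpec.coe_rounds ν hfin]
    simp
  have hlate' : ∀ᵐ ω ∂μ, BanditSpec.rounds ν g eos pt (fun _ => i₀) ≤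
      BanditSpec.rounds ν g eos pt (fun t => I t ω) := by
    filter_upwards [hlate] with ω hω
    rw [hbest, ← BanditSpec.coe_rounds ν hfin] at hω
    exact_mod_cast hω
  refine ⟨by rw [hbest]; exact ENat.natCast_ne_top _, by rw [hexp]; exact ENNReal.ofReal_ne_top, ?_⟩
  have hE0 : 0 ≤ ∫ ω, (BanditSpec.rounds ν g eos pt (fun t => I t ω) : ℝ) ∂μ :=
    integral_nonneg fun ω => Nat.cast_nonneg _
  rw [BanditSpec.regret, hexp, hbest, ENNReal.toReal_ofReal hE0, ENat.toNat_natCast]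
  have hL0 : (0 : ℝ) ≤ ν.L := Nat.cast_nonneg _
  have hlog0 : 0 ≤ Real.log K := Real.log_natCast_nonneg K
  by_cases hK : 2 ≤ K
  · have hEN : ∫ ω, (BanditSpec.rounds ν g eos pt (fun t => I t ω) : ℝ) ∂μ ≤
        (BanditSpec.canonicalLength g eos pt).toNat := by
      calc _ ≤ ∫ _ω, ((BanditSpec.canonicalLength g eos pt).toNat : ℝ) ∂μ :=
            integral_mono hint (integrable_const _)
              fun ω => Nat.cast_le.2 (BanditSpec.rounds_le ν hfin _)
        _ = _ := by simp
    have hmain := hI.integral_rounds_sub_le hK hL hfin hy i₀ hlate'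
    generalize ∫ ω, (BanditSpec.rounds ν g eos pt (fun t => I t ω) : ℝ) ∂μ = E at *
    rw [mul_min_of_nonneg _ _ (by positivity), le_min_iff]
    constructor
    · refine hmain.trans ?_
      rw [mul_assoc (_ : ℝ) (K : ℝ)]
      gcongr
    · set S := (BanditSpec.rounds ν g eos pt (fun _ => i₀) : ℝ)
      have hc0 : 0 ≤ K * Real.log K := by positivity
      have hS0 : 0 ≤ S := Nat.cast_nonneg _
      have h := BanditSpec.le_sq_add_of_le_mul_sqrt (A := 2 * ν.L * √(K * Real.log K))
        (by positivity) hS0 (x := E - S) (by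
          rw [add_sub_cancel, mul_assoc, mul_comm (√_), ← Real.sqrt_mul hE0]
          exact hmain)
      refine h.trans_eq ?_
      rw [mul_pow, Real.sq_sqrt hc0, mul_assoc S, Real.sqrt_mul hS0]
      ring
  -- With a single arm the run is the fixed-arm run, so the regret is zero.
  · have hK1 : K = 1 := by have := hne.ne; omega
    subst hK1
    have hconst : ∀ ω, (fun t => I t ω) = fun _ => i₀ := fun ω =>
      funext fun t => Subsingleton.elim _ _
    simp [hconst]
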